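/- Let $\mathbb{F}$ be a field with an involution $x\mapsto \bar x$ (an involutive field automorphism, e.g. complex conjugation on $\mathbb{C}$, or the identity on any field), and let $A^*=\bar A^{T}$ for a matrix $A$. **Butterfly matrices.** Let $N=2^m$. A butterfly factor of size $k=2^{j}\ge 2$ is a matrix $\begin{bmatrix} D_1 & D_2\\ D_3& D_4\end{bmatrix}$ with $D_i$ diagonal of size $k/2$; a butterfly factor matrix $B_k^{(N)}$ is a block diagonal matrix of $N/k$ (possibly different) butterfly factors of size $k$. $\mathcal{B}$ is the set of all products $B_N^{(N)}B_{N/2}^{(N)}\cdots B_2^{(N)}$ (for $N=1$: the identity), $\mathcal{B}\mathcal{B}^*=\{M_1M_2^* : M_1,M_2\in\mathcal{B}\}$, and $(\mathcal{B}\mathcal{B}^*)^w$ is the set of products $M_w\cdots M_1$ with all $M_i\in\mathcal{B}\mathcal{B}^*$. For a rational $e$, $(\mathcal{B}\mathcal{B}^*)^w_e$ is the set of $n\times n$ matrices that are the upper-left corner of some $en\times en$ matrix in $(\mathcal{B}\mathcal{B}^*)^w$, where $en\ge n$ is a power of two. The parameters of such a representation are the entries on the diagonals $D_i$ of all butterfly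 factors (for starred factors: of the factors as they occur in the product, that is after conjugate transposition). **Linear arithmetic circuits.** A linear arithmetic circuit with $n$ inputs has $n$ input gates and finitely many internal gates, each computing $\alpha x+\beta y$ with fixed $\alpha,\beta\in\mathbb{F}$ from the values $x,y$ of two (not necessarily distinct) earlier gates; each of its $n$ outputs is the value of some gate. Its number of gates $s$ includes the input gates. Its depth $d$ is the minimum number of layers into which the internal gates can be divided so that every gate takes its inputs from input gates and gates of strictly earlier layers. **Theorem.** There is an absolute constant $C$ such that the following holds for every such $\mathbb{F}$, all $n$ and every $M\in\mathbb{F}^{n\times n}$. Suppose that some linear arithmetic circuit with $s$ gates and depth $d\ge 1$ computes $Mv$ for every input $v\in\mathbb{F}^n$. Then there are $w\le C d$ and $e\le C s/n$ such that $$M\in(\mathcal{B}\mathcal{B}^*)^{w}_{e}.$$ Moreover, $M$ has a representation of width $w$ and expansion $e$ with at most $C\,d\,s\log s$ parameters, and there is a straight-line program with at most $C\,d\,s\log s$ field operations (additions, subtractions, multiplications) that takes as input an arbitrary vector $v\in\mathbb{F}^n$ and an arbitrary parameter vector $\theta$ for width $w$ and size $en$, and outputs $K_\theta v$, where $K_\theta$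 is the $n\times n$ matrix represented by $\theta$; for the parameters that represent $M$ it outputs $Mv$. -/

import Mathlib

open scoped Matrix

namespace Kaleidoscope

/-! ### Linear arithmetic circuits -/

/-- A linear arithmetic circuit over `F` with `n` inputs and `n` outputs.  The internal gates are
listed in a topological order.  Gate `k` computes `α k * x + β k * y`, where `x` and `y` are each an
input or the value of an earlier internal gate; this covers addition, subtraction and multiplication
by a constant.  Each output is read off at an input gate or at an internal gate. -/
structure LinearCircuit (F : Type*) (n : ℕ) where
  numGates : ℕ
  src₁ : (k : Fin numGates) → Fin n ⊕ Fin k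
  src₂ : (k : Fin numGates) → Fin n ⊕ Fin k
  α : Fin numGates → F
  β : Fin numGates → F
  out : Fin n → Fin n ⊕ Fin numGates

namespace LinearCircuit

variable {F : Type*} {n : ℕ}

/-- The value of the internal gate `k` on the input vector `v`. -/
def value [Field F] (c : LinearCircuit F n) (v : Fin n → F) (k : Fin c.numGates) : F :=
  c.α k * Sum.elim v (fun j => c.value v (j.castLE k.isLt.le)) (c.src₁ k) +
    c.β k * Sum.elim v (fun j => c.value v (j.castLE k.isLt.le)) (c.src₂ k)
termination_by k.val
decreasing_by all_goals exact j.isLt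

/-- The output vector of the circuit on the input vector `v`. -/
def eval [Field F] (c : LinearCircuit F n) (v : Fin n → F) : Fin n → F :=
  fun i => Sum.elim v (c.value v) (c.out i)

/-- The circuit computes the matrix-vector product `M v` for every vector `v`. -/
def Computes [Field F] (c : LinearCircuit F n) (M : Matrix (Fin n) (Fin n) F) : Prop :=
  ∀ v : Fin n → F, c.eval v = M *ᵥ v

/-- The total number of gates, the `n` input gates included. -/
def size (c : LinearCircuit F n) : ℕ := n + c.numGates

/-- `ℓ` distributes the internal gates over `L` layers so that every gate takes its inputs from
strictly earlier layers (or from the input layer, which is not counted). -/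
def IsLayering (c : LinearCircuit F n) (L : ℕ) (ℓ : Fin c.numGates → Fin L) : Prop :=
  ∀ (k : Fin c.numGates) (j : Fin k), c.src₁ k = Sum.inr j ∨ c.src₂ k = Sum.inr j →
    ℓ (j.castLE k.isLt.le) < ℓ k

/-- The depth of the circuit: the minimum number of layers. -/
noncomputable def depth (c : LinearCircuit F n) : ℕ :=
  sInf {L : ℕ | ∃ ℓ : Fin c.numGates → Fin L, c.IsLayering L ℓ}

end LinearCircuit

/-! ### Butterfly matrices and the kaleidoscope hierarchy -/

/-- The butterfly factor matrix of size `2 ^ m` with block size `k = 2 ^ (j + 1)`: block diagonal,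
and each diagonal block is of the form `[D₁ D₂; D₃ D₄]` with diagonal matrices `Dᵢ` of size `2 ^ j`.
So the entry `(p, q)` may be nonzero only if `p` and `q` lie in the same block of size `2 ^ (j + 1)`
and have the same position inside their halves of that block.  There are two such entries in row
`p`, namely `a p 0` (left half of the block) and `a p 1` (right half of the block). -/
def butterflyFactorMatrix {F : Type*} [Zero F] (m j : ℕ) (a : Fin (2 ^ m) → Fin 2 → F) :
    Matrix (Fin (2 ^ m)) (Fin (2 ^ m)) F :=
  Matrix.of fun p q =>
    if (p : ℕ) / 2 ^ (j + 1) = (q : ℕ) / 2 ^ (j + 1) ∧ (p : ℕ) % 2 ^ j = (q : ℕ) % 2 ^ j then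
      a p (Fin.ofNat 2 ((q : ℕ) / 2 ^ j))
    else 0

/-- The parameters of a butterfly matrix of size `2 ^ m`: two for every row of each of the `m`
butterfly factor matrices. -/
abbrev ButterflyParam (m : ℕ) : Type := Fin m × Fin (2 ^ m) × Fin 2

/-- The butterfly matrix `B_N B_{N/2} ⋯ B_4 B_2` of size `N = 2 ^ m` with parameters `θ`. -/
def butterflyMatrix {F : Type*} [Field F] {m : ℕ} (θ : ButterflyParam m → F) :
    Matrix (Fin (2 ^ m)) (Fin (2 ^ m)) F :=
  (List.ofFn fun j : Fin m =>
    butterflyFactorMatrix m (j : ℕ) (fun p c => θ (j, p, c))).reverse.prod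

/-- The set `𝓑` of butterfly matrices (those of size `2 ^ m`). -/
def Butterfly (F : Type*) [Field F] (m : ℕ) : Set (Matrix (Fin (2 ^ m)) (Fin (2 ^ m)) F) :=
  Set.range butterflyMatrix

/-- The set `𝓑𝓑*` of products `M₁ M₂ᴴ` with `M₁, M₂ ∈ 𝓑` (those of size `2 ^ m`). -/
def BBStar (F : Type*) [Field F] [StarRing F] (m : ℕ) :
    Set (Matrix (Fin (2 ^ m)) (Fin (2 ^ m)) F) :=
  {A | ∃ M₁ ∈ Butterfly F m, ∃ M₂ ∈ Butterfly F m, A = M₁ * M₂ᴴ}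

/-- The set `(𝓑𝓑*)^w` of products `M_w ⋯ M₂ M₁` with all `Mᵢ ∈ 𝓑𝓑*` (those of size `2 ^ m`). -/
def BBStarPow (F : Type*) [Field F] [StarRing F] (m w : ℕ) :
    Set (Matrix (Fin (2 ^ m)) (Fin (2 ^ m)) F) :=
  {A | ∃ f : Fin w → Matrix (Fin (2 ^ m)) (Fin (2 ^ m)) F,
    (∀ i, f i ∈ BBStar F m) ∧ A = (List.ofFn f).reverse.prod}

/-- The upper-left `n × n` corner of an `N × N` matrix, `n ≤ N`. -/
def upperLeft {F : Type*} {n N : ℕ} (h : n ≤ N) (E : Matrix (Fin N) (Fin N) F) :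
    Matrix (Fin n) (Fin n) F :=
  E.submatrix (Fin.castLE h) (Fin.castLE h)

/-- The class `(𝓑𝓑*)^w_e` of `n × n` matrices: the upper-left corners of the `e n × e n` matrices in
`(𝓑𝓑*)^w`.  As `e n` is a power of two, `e` has to be a rational number when `n` is not a power
of two. -/
def KClass (F : Type*) [Field F] [StarRing F] (n w : ℕ) (e : ℚ) :
    Set (Matrix (Fin n) (Fin n) F) :=
  {M | ∃ (m : ℕ) (h : n ≤ 2 ^ m), (2 : ℚ) ^ m = e * n ∧
    ∃ E ∈ BBStarPow F m w, M = upperLeft h E}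

/-! ### Representations, their parameters, and algorithms -/

/-- The parameters of a product of `w` matrices of `𝓑𝓑*` of size `2 ^ m`: the entries of the
butterfly factors of the `i`-th `𝓑` part (`(i, false, _)`) and of the `i`-th `𝓑*` part
(`(i, true, _)`). -/
abbrev KParam (w m : ℕ) : Type := Fin w × Bool × ButterflyParam m

/-- The `n × n` matrix represented by the parameters `θ`, that is the upper-left corner of the
product of the `w` matrices of `𝓑𝓑*` given by `θ`.  The parameters of a `𝓑*` part are the entries
that its (conjugate transposed) factors have in the product. -/
def kMatrix {F : Type*} [Field F] [StarRing F] {n w m : ℕ} (h : n ≤ 2 ^ m)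
    (θ : KParam w m → F) : Matrix (Fin n) (Fin n) F :=
  upperLeft h (List.ofFn fun i : Fin w =>
    butterflyMatrix (fun p => θ (i, false, p)) *
      (butterflyMatrix (fun p => star (θ (i, true, p))))ᴴ).reverse.prod

/-- The field operations that a program may use. -/
inductive FieldOp
  | add
  | sub
  | mul

/-- The field operation, applied. -/
def FieldOp.apply {F : Type*} [Field F] : FieldOp → F → F → F
  | .add, x, y => x + y
  | .sub, x, y => x - y
  | .mul, x, y => x * y

/-- An instruction `dst := arg₁ op arg₂`.  An argument is a read-only input register (indexed by
`ι`) or a work register (indexed by `ℕ`); the destination is a work register. -/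
structure Instr (ι : Type*) where
  dst : ℕ
  op : FieldOp
  arg₁ : ι ⊕ ℕ
  arg₂ : ι ⊕ ℕ

/-- A straight-line program with inputs indexed by `ι` and outputs indexed by `o`. -/
structure Program (ι o : Type*) where
  code : List (Instr ι)
  out : o → ι ⊕ ℕ

namespace Program

variable {F ι o : Type*}

/-- The running time: the number of field operations that are carried out. -/
def numOps (P : Program ι o) : ℕ := P.code.length

/-- The effect of one instruction on the work registers, for the input `x`. -/
def step [Field F] (x : ι → F) (r : ℕ → F) (I : Instr ι) : ℕ → F :=
  Function.update r I.dst (I.op.apply (Sum.elim x r I.arg₁) (Sum.elim x r I.arg₂))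

/-- The output of the program on the input `x`; all work registers contain `0` at the start. -/
def eval [Field F] (P : Program ι o) (x : ι → F) : o → F :=
  fun i => Sum.elim x (P.code.foldl (step x) (fun _ => 0)) (P.out i)

end Program

end Kaleidoscope

namespace Kaleidoscope

/-! ### Binary digits of indices -/

/-! The circuit is simulated layer by layer on a vector with one slot per input and gate. Let `2 ^ m
≥ s`, and use matrices of size `2 ^ (m + 1)`, so that there are two halves. For each layer, a
copying matrix `x ↦ x ∘ f` brings the first argument of slot `i` to position `i` and the second to
position `i + 2 ^ m`. One butterfly factor for the top digit then forms the combinations `α x + β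
y`. Slots outside the layer keep their value.

The substance is that an arbitrary copying matrix is a product of three matrices of `𝓑𝓑*`
(`copyMatrix_mem_BBStarPow`). A map `f` is a permutation, then a map that does not increase
distances, then a permutation (`exists_perm_lipschitz`). Permutations are Beneš networks, built
recursively by two-colouring (`copyMatrix_perm_mem_benesSet`). A map that does not increase
distances can be routed by correcting one binary digit at a time without collisions
(`copyMatrix_lipschitz_mem_benesSet`).

A layer thus costs width 4 and the final selection of outputs width 3, so `w = 3 + 4 d`. Each
butterfly factor acts with three operations per row, which gives `O(w m 2 ^ m) = O(d s log s)`
operations. -/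

/-- `p` and `q` have the same binary digits, except possibly the digit number `j`. -/
def AgreeOffBit {m : ℕ} (j : ℕ) (p q : Fin (2 ^ m)) : Prop :=
  (p : ℕ) / 2 ^ (j + 1) = (q : ℕ) / 2 ^ (j + 1) ∧ (p : ℕ) % 2 ^ j = (q : ℕ) % 2 ^ j

/-- The binary digit number `j` of `p`. -/
def bit {m : ℕ} (j : ℕ) (p : Fin (2 ^ m)) : Fin 2 := Fin.ofNat 2 ((p : ℕ) / 2 ^ j)

theorem div_pow_succ (p j : ℕ) : p / 2 ^ (j + 1) = p / 2 ^ j / 2 := by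
  rw [pow_succ, Nat.div_div_eq_div_mul]

theorem insertBit_div {j r : ℕ} (a c : ℕ) (hr : r < 2 ^ j) :
    (a * 2 ^ (j + 1) + c * 2 ^ j + r) / 2 ^ j = 2 * a + c := by
  have : a * 2 ^ (j + 1) + c * 2 ^ j + r = r + 2 ^ j * (2 * a + c) := by ring
  rw [this, Nat.add_mul_div_left _ _ (by positivity), Nat.div_eq_of_lt hr, zero_add]

theorem insertBit_mod {j r : ℕ} (a c : ℕ) (hr : r < 2 ^ j) :
    (a * 2 ^ (j + 1) + c * 2 ^ j + r) % 2 ^ j = r := by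
  have : a * 2 ^ (j + 1) + c * 2 ^ j + r = r + 2 ^ j * (2 * a + c) := by ring
  rw [this, Nat.add_mul_mod_self_left, Nat.mod_eq_of_lt hr]

/-- Replace the binary digit number `j` of `p` by `c`. -/
def setBit {m j : ℕ} (hj : j < m) (p : Fin (2 ^ m)) (c : Fin 2) : Fin (2 ^ m) :=
  ⟨(p : ℕ) / 2 ^ (j + 1) * 2 ^ (j + 1) + c * 2 ^ j + (p : ℕ) % 2 ^ j, by
    have hr : (p : ℕ) % 2 ^ j < 2 ^ j := Nat.mod_lt _ (by positivity)
    have h2 : 2 ^ m = 2 ^ (m - j - 1) * 2 ^ (j + 1) := by rw [← pow_add]; congr 1; omega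
    have ha : (p : ℕ) / 2 ^ (j + 1) < 2 ^ (m - j - 1) := by
      rw [Nat.div_lt_iff_lt_mul (by positivity), ← h2]; exact p.isLt
    have h3 : ((p : ℕ) / 2 ^ (j + 1) + 1) * 2 ^ (j + 1) ≤ 2 ^ m := by
      exact (Nat.mul_le_mul_right _ ha).trans_eq h2.symm
    have h4 : (c : ℕ) * 2 ^ j ≤ 1 * 2 ^ j := Nat.mul_le_mul_right _ (by omega)
    rw [Nat.pow_succ'] at *
    lia⟩

theorem agreeOffBit_setBit {m j : ℕ} (hj : j < m) (p : Fin (2 ^ m)) (c : Fin 2) :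
    AgreeOffBit j (setBit hj p c) p := by
  have hr : (p : ℕ) % 2 ^ j < 2 ^ j := Nat.mod_lt _ (by positivity)
  refine ⟨?_, insertBit_mod _ _ hr⟩
  rw [div_pow_succ]
  simp only [setBit]
  rw [insertBit_div _ _ hr]
  omega

theorem bit_setBit {m j : ℕ} (hj : j < m) (p : Fin (2 ^ m)) (c : Fin 2) :
    bit j (setBit hj p c) = c := by
  have hr : (p : ℕ) % 2 ^ j < 2 ^ j := Nat.mod_lt _ (by positivity)
  apply Fin.ext
  simp only [bit, setBit, Fin.ofNat]
  rw [insertBit_div _ _ hr]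
  omega

theorem AgreeOffBit.refl {m : ℕ} (j : ℕ) (p : Fin (2 ^ m)) : AgreeOffBit j p p := ⟨rfl, rfl⟩

theorem AgreeOffBit.symm {m j : ℕ} {p q : Fin (2 ^ m)} (h : AgreeOffBit j p q) :
    AgreeOffBit j q p := ⟨h.1.symm, h.2.symm⟩

theorem AgreeOffBit.trans {m j : ℕ} {p q r : Fin (2 ^ m)} (h : AgreeOffBit j p q)
    (h' : AgreeOffBit j q r) : AgreeOffBit j p r := ⟨h.1.trans h'.1, h.2.trans h'.2⟩

theorem AgreeOffBit.eq {m j : ℕ} {p q : Fin (2 ^ m)} (h : AgreeOffBit j p q)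
    (hb : bit j p = bit j q) : p = q := by
  have h1 := h.1
  have hb' := congrArg Fin.val hb
  simp only [bit, Fin.ofNat] at hb'
  rw [div_pow_succ, div_pow_succ] at h1
  have h3 : (p : ℕ) / 2 ^ j = (q : ℕ) / 2 ^ j := by omega
  apply Fin.ext
  rw [← Nat.div_add_mod (p : ℕ) (2 ^ j), h3, h.2, Nat.div_add_mod]

theorem AgreeOffBit.setBit_eq {m j : ℕ} (hj : j < m) {p q : Fin (2 ^ m)} (h : AgreeOffBit j p q) :
    setBit hj p (bit j q) = q :=
  ((agreeOffBit_setBit hj p _).trans h).eq (bit_setBit hj p _)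

/-! ### Butterfly factors and Beneš networks -/

section Matrices

variable {F : Type*} [Field F] {m : ℕ}

/-- `A` is a butterfly factor matrix for the binary digit `j`. -/
def IsFactor (j : ℕ) (A : Matrix (Fin (2 ^ m)) (Fin (2 ^ m)) F) : Prop :=
  ∀ p q, ¬ AgreeOffBit j p q → A p q = 0

theorem isFactor_butterflyFactorMatrix (j : ℕ) (a : Fin (2 ^ m) → Fin 2 → F) :
    IsFactor j (butterflyFactorMatrix m j a) := fun p q h => by
  unfold AgreeOffBit at h
  simp [butterflyFactorMatrix, h]

/-- Row `p` is supported on the two columns `setBit hj p 0` and `setBit hj p 1`, and these two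
entries are its parameters. Constructions can therefore work with the support condition alone. -/
theorem IsFactor.eq_butterflyFactorMatrix {j : ℕ} (hj : j < m)
    {A : Matrix (Fin (2 ^ m)) (Fin (2 ^ m)) F} (hA : IsFactor j A) :
    A = butterflyFactorMatrix m j (fun p c => A p (setBit hj p c)) := by
  ext p q
  by_cases h : AgreeOffBit j p q
  · have h' := h
    unfold AgreeOffBit at h'
    simp only [butterflyFactorMatrix, Matrix.of_apply, if_pos h']
    exact congrArg (A p) (h.setBit_eq hj).symm
  · rw [hA p q h, isFactor_butterflyFactorMatrix j _ p q h]

theorem IsFactor.conjTranspose [StarRing F] {j : ℕ} {A : Matrix (Fin (2 ^ m)) (Fin (2 ^ m)) F}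
    (hA : IsFactor j A) : IsFactor j Aᴴ := fun p q h => by
  rw [Matrix.conjTranspose_apply, hA q p fun h' => h h'.symm, star_zero]

theorem isFactor_one (j : ℕ) : IsFactor j (1 : Matrix (Fin (2 ^ m)) (Fin (2 ^ m)) F) :=
  fun p _ h => Matrix.one_apply_ne fun e => h (e ▸ AgreeOffBit.refl j p)

/-- The products `A_{k-1} ⋯ A_0 A'_0 ⋯ A'_{k-1}` of butterfly factor matrices, `A_j` and `A'_j`
for the binary digit `j`. -/
def BenesSet (F : Type*) [Field F] (m : ℕ) : ℕ → Set (Matrix (Fin (2 ^ m)) (Fin (2 ^ m)) F)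
  | 0 => {1}
  | k + 1 => {X | ∃ A, IsFactor k A ∧ ∃ B ∈ BenesSet F m k, ∃ C, IsFactor k C ∧ X = A * B * C}

theorem one_mem_benesSet (k : ℕ) : 1 ∈ BenesSet F m k := by
  induction k with
  | zero => rfl
  | succ k ih => exact ⟨1, isFactor_one k, 1, ih, 1, isFactor_one k, by simp⟩

/-- The right half has increasing digits, so as a conjugate transpose it becomes a product with
decreasing digits, as in `𝓑`. Families indexed by all of `ℕ` let the induction adjoin the outermost
factors with `Function.update`. -/
theorem exists_prod_of_mem_benesSet [StarRing F] {k : ℕ}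
    {X : Matrix (Fin (2 ^ m)) (Fin (2 ^ m)) F} (hX : X ∈ BenesSet F m k) :
    ∃ A B : ℕ → Matrix (Fin (2 ^ m)) (Fin (2 ^ m)) F,
      (∀ j, IsFactor j (A j)) ∧ (∀ j, IsFactor j (B j)) ∧
      X = ((List.range k).map A).reverse.prod * (((List.range k).map B).reverse.prod)ᴴ := by
  induction k generalizing X with
  | zero =>
    rw [show X = 1 from hX]
    exact ⟨fun _ => 1, fun _ => 1, fun j => isFactor_one j, fun j => isFactor_one j, by simp⟩
  | succ k ih =>
    obtain ⟨P, hP, Y, hY, Q, hQ, rfl⟩ := hX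
    obtain ⟨A, B, hA, hB, rfl⟩ := ih hY
    have key : ∀ (A : ℕ → Matrix (Fin (2 ^ m)) (Fin (2 ^ m)) F) (P),
        ((List.range (k + 1)).map (Function.update A k P)).reverse.prod =
          P * ((List.range k).map A).reverse.prod := by
      intro A P
      have : (List.range k).map (Function.update A k P) = (List.range k).map A :=
        List.map_congr_left fun j hj =>
          Function.update_of_ne (List.mem_range.1 hj).ne _ _
      rw [List.range_succ, List.map_append, this]
      simp
    have upd : ∀ (A : ℕ → Matrix (Fin (2 ^ m)) (Fin (2 ^ m)) F) (P), IsFactor k P →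
        (∀ j, IsFactor j (A j)) → ∀ j, IsFactor j (Function.update A k P j) := by
      intro A P hP hA j
      rcases eq_or_ne j k with rfl | h
      · simpa using hP
      · simpa [h] using hA j
    refine ⟨Function.update A k P, Function.update B k Qᴴ, upd A P hP hA,
      upd B _ hQ.conjTranspose hB, ?_⟩
    rw [key, key, Matrix.conjTranspose_mul, Matrix.conjTranspose_conjTranspose]
    simp only [Matrix.mul_assoc]

theorem prod_mem_butterfly {A : ℕ → Matrix (Fin (2 ^ m)) (Fin (2 ^ m)) F}
    (hA : ∀ j, IsFactor j (A j)) : ((List.range m).map A).reverse.prod ∈ Butterfly F m := by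
  refine ⟨fun t => A t.1 t.2.1 (setBit t.1.isLt t.2.1 t.2.2), ?_⟩
  unfold butterflyMatrix
  congr 2
  rw [← List.map_coe_finRange_eq_range, List.map_map, List.ofFn_eq_map]
  exact List.map_congr_left fun j _ => ((hA j).eq_butterflyFactorMatrix j.isLt).symm

theorem benesSet_subset_BBStar [StarRing F] : BenesSet F m m ⊆ BBStar F m := fun X hX => by
  obtain ⟨A, B, hA, hB, rfl⟩ := exists_prod_of_mem_benesSet hX
  exact ⟨_, prod_mem_butterfly hA, _, prod_mem_butterfly hB, rfl⟩

/-- The matrix of the linear map `x ↦ x ∘ f`. -/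
def copyMatrix {ι : Type*} [DecidableEq ι] (F : Type*) [Field F] (f : ι → ι) : Matrix ι ι F :=
  Matrix.of fun p q => if f p = q then 1 else 0

theorem copyMatrix_mulVec {ι : Type*} [Fintype ι] [DecidableEq ι] (f : ι → ι) (x : ι → F) :
    copyMatrix F f *ᵥ x = x ∘ f := by
  ext p
  simp [copyMatrix, Matrix.mulVec, dotProduct]

theorem copyMatrix_id {ι : Type*} [DecidableEq ι] : copyMatrix F (id : ι → ι) = 1 := by
  ext p q
  simp [copyMatrix, Matrix.one_apply]

theorem copyMatrix_comp {ι : Type*} [Fintype ι] [DecidableEq ι] (f g : ι → ι) :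
    copyMatrix F (f ∘ g) = copyMatrix F g * copyMatrix F f := by
  ext p q
  simp only [copyMatrix, Matrix.mul_apply, Matrix.of_apply, Function.comp, ite_mul, one_mul,
    zero_mul, Finset.sum_ite_eq, Finset.mem_univ, if_true]

theorem isFactor_copyMatrix {j : ℕ} {f : Fin (2 ^ m) → Fin (2 ^ m)}
    (hf : ∀ p, AgreeOffBit j p (f p)) : IsFactor j (copyMatrix F f) := fun p q h => by
  exact if_neg fun e : f p = q => h (e ▸ hf p)

end Matrices

/-! ### Permutations -/

theorem apply_inv_self {X : Type*} (π : Equiv.Perm X) (x : X) : π (π⁻¹ x) = x :=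
  Equiv.apply_symm_apply π x

/-- A fixed-point-free involution has a two-colouring. -/
theorem exists_twoColouring {X : Type*} (a : X → X) (ha : ∀ x, a (a x) = x) (ha' : ∀ x, a x ≠ x) :
    ∃ c : X → Fin 2, ∀ x, c (a x) ≠ c x := by
  classical
  -- A well-ordering of `X` singles out the smaller element of each pair `{x, a x}`.
  let _ : LinearOrder X := linearOrderOfSTO WellOrderingRel
  refine ⟨fun x => if x < a x then 0 else 1, fun x => ?_⟩
  rcases lt_or_gt_of_ne (ha' x) with h | h
  · simp [ha, h, h.not_gt]
  · simp [ha, h, h.not_gt]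

/-- Two fixed-point-free involutions have a common two-colouring. -/
theorem exists_common_twoColouring {X : Type*} (a b : Equiv.Perm X) (ha : a * a = 1)
    (hb : b * b = 1) (ha' : ∀ x, a x ≠ x) (hb' : ∀ x, b x ≠ x) :
    ∃ c : X → Fin 2, (∀ x, c (a x) ≠ c x) ∧ ∀ x, c (b x) ≠ c x := by
  have ai : a⁻¹ = a := inv_eq_of_mul_eq_one_left ha
  have bi : b⁻¹ = b := inv_eq_of_mul_eq_one_left hb
  have conj : ∀ k : ℤ, a * (a * b) ^ k = (a * b) ^ (-k) * a := by
    intro k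
    have h : a * (a * b) * a⁻¹ = (a * b)⁻¹ := by rw [mul_inv_rev, ai, bi, ← mul_assoc, ha, one_mul]
    rw [zpow_neg, ← inv_zpow, ← h, conj_zpow, inv_mul_cancel_right]
  -- Joining each `x` to `a x` and `b x` gives even cycles or infinite paths. Each component is the
  -- union of two orbits of `a * b`, interchanged by both `a` and `b`; these orbits are the colour
  -- classes.
  let r : Setoid X := Equiv.Perm.SameCycle.setoid (a * b)
  have hr : ∀ x y, r x y → r (a x) (a y) := by
    rintro x y ⟨k, rfl⟩
    refine ⟨-k, ?_⟩
    rw [← Equiv.Perm.mul_apply, ← conj, Equiv.Perm.mul_apply]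
  have hne : ∀ x, ¬ r (a x) x := by
    intro x h
    obtain ⟨k, hk⟩ := Setoid.symm h
    -- If `a x = (a * b) ^ k x`, then `(a * b) ^ l x` is fixed by `a` when `k = 2 l`, and by `b`
    -- when `k = 2 l + 1`.
    obtain ⟨l, rfl | rfl⟩ := Int.even_or_odd' k
    · apply ha' (((a * b) ^ l) x)
      rw [← Equiv.Perm.mul_apply, conj, Equiv.Perm.mul_apply, ← hk, ← Equiv.Perm.mul_apply,
        ← zpow_add]
      congr 2; ring
    · apply hb' (((a * b) ^ l) x)
      apply a.injective
      have h1 : a (((a * b) ^ l) x) = ((a * b) ^ (l + 1)) x := by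
        rw [← Equiv.Perm.mul_apply, conj, Equiv.Perm.mul_apply, ← hk, ← Equiv.Perm.mul_apply,
          ← zpow_add]
        congr 2; ring
      rw [← Equiv.Perm.mul_apply, ← Equiv.Perm.mul_apply, h1, add_comm, zpow_one_add]
  obtain ⟨c, hc⟩ := exists_twoColouring (X := Quotient r) (Quotient.map a hr)
    (by
      rintro ⟨x⟩
      exact congrArg (Quotient.mk r) (DFunLike.congr_fun ha x))
    (by
      rintro ⟨x⟩ h
      exact hne x (Quotient.exact h))
  refine ⟨fun x => c (Quotient.mk r x), fun x => hc (Quotient.mk r x), fun x => ?_⟩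
  -- Since `b = a * (a * b)`, the maps `a` and `b` agree on the quotient.
  have h1 : Quotient.mk r ((a * b) x) = Quotient.mk r x :=
    Quotient.sound (Setoid.symm ⟨1, by simp⟩)
  have h2 : a ((a * b) x) = b x := by
    rw [Equiv.Perm.mul_apply, ← Equiv.Perm.mul_apply a, ha, Equiv.Perm.one_apply]
  have h3 := hc (Quotient.mk r ((a * b) x))
  rw [h1] at h3
  have h4 : Quotient.mk r (b x) = Quotient.map a hr (Quotient.mk r x) := by
    rw [← h1, ← h2]; rfl
  change c (Quotient.mk r (b x)) ≠ _
  rw [h4]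
  exact h3

section Permutations

variable {F : Type*} [Field F] {m : ℕ}

/-- Flip the binary digit number `j`. -/
def flipBit {j : ℕ} (hj : j < m) (p : Fin (2 ^ m)) : Fin (2 ^ m) := setBit hj p (bit j p + 1)

theorem agreeOffBit_flipBit {j : ℕ} (hj : j < m) (p : Fin (2 ^ m)) :
    AgreeOffBit j (flipBit hj p) p := agreeOffBit_setBit hj p _

theorem bit_flipBit {j : ℕ} (hj : j < m) (p : Fin (2 ^ m)) :
    bit j (flipBit hj p) = bit j p + 1 := bit_setBit hj p _

theorem flipBit_flipBit {j : ℕ} (hj : j < m) (p : Fin (2 ^ m)) :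
    flipBit hj (flipBit hj p) = p := by
  refine ((agreeOffBit_flipBit hj _).trans (agreeOffBit_flipBit hj p)).eq ?_
  rw [bit_flipBit, bit_flipBit]
  generalize bit j p = c
  revert c; decide

theorem flipBit_ne {j : ℕ} (hj : j < m) (p : Fin (2 ^ m)) : flipBit hj p ≠ p := fun h => by
  have := congrArg (bit j) h
  rw [bit_flipBit] at this
  generalize bit j p = c at this
  revert c; decide

theorem AgreeOffBit.eq_or_eq_flipBit {j : ℕ} (hj : j < m) {p q : Fin (2 ^ m)}
    (h : AgreeOffBit j p q) : p = q ∨ p = flipBit hj q := by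
  by_cases hb : bit j p = bit j q
  · exact Or.inl (h.eq hb)
  · refine Or.inr ((h.trans (agreeOffBit_flipBit hj q).symm).eq ?_)
    rw [bit_flipBit]
    generalize bit j p = c at *
    generalize bit j q = c' at *
    revert c c'; decide

theorem setBit_injective {j : ℕ} (hj : j < m) {c : Fin (2 ^ m) → Fin 2}
    (hc : ∀ p, c (flipBit hj p) ≠ c p) : Function.Injective fun p => setBit hj p (c p) := by
  intro p q h
  have h : setBit hj p (c p) = setBit hj q (c q) := h
  have hcc : c p = c q := by rw [← bit_setBit hj p (c p), h, bit_setBit]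
  have ha : AgreeOffBit j p q :=
    (agreeOffBit_setBit hj p (c p)).symm.trans (h ▸ agreeOffBit_setBit hj q (c q))
  rcases ha.eq_or_eq_flipBit hj with h | rfl
  · exact h
  · exact absurd hcc (hc q)

/-- The Beneš network: a permutation within the blocks of size `2 ^ k`. -/
theorem copyMatrix_perm_mem_benesSet {k : ℕ} (hk : k ≤ m) (π : Equiv.Perm (Fin (2 ^ m)))
    (hπ : ∀ p, (π p : ℕ) / 2 ^ k = (p : ℕ) / 2 ^ k) : copyMatrix F π ∈ BenesSet F m k := by
  induction k generalizing π with
  | zero =>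
    have : π = 1 := Equiv.ext fun p => Fin.ext (by simpa using hπ p)
    subst this
    exact copyMatrix_id
  | succ k ih =>
    have hj : k < m := hk
    let a : Equiv.Perm (Fin (2 ^ m)) :=
      ⟨flipBit hj, flipBit hj, flipBit_flipBit hj, flipBit_flipBit hj⟩
    have ha : a * a = 1 := Equiv.ext (flipBit_flipBit hj)
    -- The colour `c p` chooses the half-size network through which the value for position `p`
    -- passes. Partners `p`, `flipBit hj p` must use different halves, and so must positions whose
    -- images under `π` are partners. Setting digit `k` to the colour on both sides (`ρ` and `L`)
    -- leaves `L * π * ρ⁻¹`, which preserves digit `k`.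
    obtain ⟨c, hc, hc'⟩ := exists_common_twoColouring a (π⁻¹ * a * π) ha
      (by simp only [mul_assoc, mul_inv_cancel_left]; rw [← mul_assoc a, ha]; simp)
      (flipBit_ne hj)
      (fun x h => flipBit_ne hj (π x) (by
        have := congrArg π h
        rwa [Equiv.Perm.mul_apply, Equiv.Perm.mul_apply, ← Equiv.Perm.mul_apply π,
          mul_inv_cancel, Equiv.Perm.one_apply] at this))
    let ρ : Equiv.Perm (Fin (2 ^ m)) := Equiv.ofBijective _
      (Finite.injective_iff_bijective.1 (setBit_injective hj hc))
    have hL : ∀ y, c (π⁻¹ (flipBit hj y)) ≠ c (π⁻¹ y) := fun y => by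
      have := hc' (π⁻¹ y)
      rwa [Equiv.Perm.mul_apply, Equiv.Perm.mul_apply, ← Equiv.Perm.mul_apply π,
          mul_inv_cancel, Equiv.Perm.one_apply] at this
    let L : Equiv.Perm (Fin (2 ^ m)) := Equiv.ofBijective _
      (Finite.injective_iff_bijective.1 (setBit_injective (c := fun y => c (π⁻¹ y)) hj hL))
    have hρ : ∀ p, ρ p = setBit hj p (c p) := fun p => rfl
    have hL' : ∀ p, L p = setBit hj p (c (π⁻¹ p)) := fun p => rfl
    have agree : ∀ p, AgreeOffBit k p (ρ p) := fun p => (agreeOffBit_setBit hj _ _).symm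
    have agree' : ∀ p, AgreeOffBit k p (L⁻¹ p) := fun p => by
      have := agreeOffBit_setBit hj (L⁻¹ p) (c (π⁻¹ (L⁻¹ p)))
      rwa [← hL', apply_inv_self] at this
    refine ⟨copyMatrix F ρ, isFactor_copyMatrix agree, copyMatrix F (L * π * ρ⁻¹ : Equiv.Perm _),
      ih hj.le _ fun p => ?_, copyMatrix F (L⁻¹ : Equiv.Perm _), isFactor_copyMatrix agree', ?_⟩
    · obtain ⟨x, rfl⟩ := ρ.surjective p
      have e : (L * π * ρ⁻¹ : Equiv.Perm _) (ρ x) = L (π x) := by simp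
      rw [e]
      have hb : bit k (L (π x)) = bit k (ρ x) := by
        rw [hL', hρ, bit_setBit, bit_setBit]; simp
      have hd : (L (π x) : ℕ) / 2 ^ (k + 1) = (ρ x : ℕ) / 2 ^ (k + 1) := by
        rw [hL', hρ, (agreeOffBit_setBit hj _ _).1, (agreeOffBit_setBit hj _ _).1, hπ]
      have hb' := congrArg Fin.val hb
      simp only [bit, Fin.ofNat] at hb'
      rw [div_pow_succ, div_pow_succ] at hd
      omega
    · rw [mul_assoc, ← copyMatrix_comp, ← copyMatrix_comp]
      congr 1
      ext p
      simp

end Permutations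

/-! ### Copying -/

section Copying

variable {F : Type*} [Field F] {m : ℕ}

/-- The address with the binary digits `≥ k` of `i` and the binary digits `< k` of `g`. -/
def mixBits (k : ℕ) (i g : Fin (2 ^ m)) : ℕ := (i : ℕ) / 2 ^ k * 2 ^ k + (g : ℕ) % 2 ^ k

theorem mixBits_div (k : ℕ) (i g : Fin (2 ^ m)) : mixBits k i g / 2 ^ k = (i : ℕ) / 2 ^ k := by
  rw [mixBits, mul_comm, Nat.mul_add_div (by positivity),
    Nat.div_eq_of_lt (Nat.mod_lt _ (by positivity)), add_zero]

theorem mixBits_mod (k : ℕ) (i g : Fin (2 ^ m)) : mixBits k i g % 2 ^ k = (g : ℕ) % 2 ^ k := by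
  rw [mixBits, mul_comm, Nat.mul_add_mod, Nat.mod_mod]

theorem mixBits_lt {k : ℕ} (hk : k ≤ m) (i g : Fin (2 ^ m)) : mixBits k i g < 2 ^ m := by
  have h2 : 2 ^ m = 2 ^ (m - k) * 2 ^ k := by rw [← pow_add]; congr 1; omega
  have h : mixBits k i g / 2 ^ k < 2 ^ (m - k) := by
    rw [mixBits_div, Nat.div_lt_iff_lt_mul (by positivity), ← h2]; exact i.isLt
  rwa [Nat.div_lt_iff_lt_mul (by positivity), ← h2] at h

/-- A map that does not increase distances can be routed digit by digit. -/
theorem copyMatrix_lipschitz_mem_benesSet (g : Fin (2 ^ m) → Fin (2 ^ m))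
    (hg : ∀ i i', Nat.dist (g i) (g i') ≤ Nat.dist i i') : copyMatrix F g ∈ BenesSet F m m := by
  -- After `k` stages the low `k` digits are those of `g i` and the others still those of `i`.
  have key : ∀ k (hk : k ≤ m),
      copyMatrix F (fun i => (⟨mixBits k i (g i), mixBits_lt hk i (g i)⟩ : Fin (2 ^ m))) ∈
        BenesSet F m k := by
    intro k
    induction k with
    | zero =>
      intro hk
      have : (fun i => (⟨mixBits 0 i (g i), mixBits_lt hk i (g i)⟩ : Fin (2 ^ m))) = id := by
        ext i; simp [mixBits, Nat.mod_one]
      rw [this]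
      exact copyMatrix_id
    | succ k ih =>
      intro hk
      have hk' : k ≤ m := by omega
      set h : Fin (2 ^ m) → Fin (2 ^ m) := fun i => ⟨mixBits k i (g i), mixBits_lt hk' i (g i)⟩
        with hh
      set h' : Fin (2 ^ m) → Fin (2 ^ m) :=
        fun i => ⟨mixBits (k + 1) i (g i), mixBits_lt hk i (g i)⟩ with hh'
      -- No harmful collisions: if `h i = h i'`, then `i` and `i'` lie in one block of size `2 ^ k`,
      -- so `g i` and `g i'` are less than `2 ^ k` apart; being congruent modulo `2 ^ k`, they are
      -- equal.
      have fac : Function.FactorsThrough h' h := by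
        intro i i' e
        have e : mixBits k i (g i) = mixBits k i' (g i') := congrArg Fin.val e
        have e1 : (i : ℕ) / 2 ^ k = (i' : ℕ) / 2 ^ k := by
          rw [← mixBits_div k i (g i), e, mixBits_div]
        have e2 : (g i : ℕ) % 2 ^ k = (g i' : ℕ) % 2 ^ k := by
          rw [← mixBits_mod k i (g i), e, mixBits_mod]
        have d1 := Nat.div_add_mod (i : ℕ) (2 ^ k)
        have d2 := Nat.div_add_mod (i' : ℕ) (2 ^ k)
        have l1 : (i : ℕ) % 2 ^ k < 2 ^ k := Nat.mod_lt _ (by positivity)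
        have l2 : (i' : ℕ) % 2 ^ k < 2 ^ k := Nat.mod_lt _ (by positivity)
        have l3 : (g i' : ℕ) % 2 ^ k < 2 ^ k := Nat.mod_lt _ (by positivity)
        rw [e1] at d1
        have hd := hg i i'
        simp only [Nat.dist] at hd
        have e3 : (g i : ℕ) / 2 ^ k = (g i' : ℕ) / 2 ^ k := by
          have d3 := Nat.div_add_mod (g i : ℕ) (2 ^ k)
          have d4 := Nat.div_add_mod (g i' : ℕ) (2 ^ k)
          rcases lt_trichotomy ((g i : ℕ) / 2 ^ k) ((g i' : ℕ) / 2 ^ k) with lt | eq | lt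
          · have := Nat.mul_le_mul_left (2 ^ k) (Nat.succ_le_of_lt lt)
            rw [Nat.mul_succ] at this
            omega
          · exact eq
          · have := Nat.mul_le_mul_left (2 ^ k) (Nat.succ_le_of_lt lt)
            rw [Nat.mul_succ] at this
            omega
        have e4 : (g i : ℕ) = g i' := by
          rw [← Nat.div_add_mod (g i : ℕ) (2 ^ k), e3, e2, Nat.div_add_mod]
        apply Fin.ext
        simp only [hh', mixBits, e4, div_pow_succ, e1]
      have agree : ∀ q, AgreeOffBit k q (Function.extend h h' id q) := by
        intro q
        by_cases hq : ∃ i, h i = q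
        · obtain ⟨i, rfl⟩ := hq
          rw [fac.extend_apply]
          constructor
          · change mixBits k i (g i) / _ = mixBits (k + 1) i (g i) / _
            rw [mixBits_div, div_pow_succ, mixBits_div, div_pow_succ]
          · change mixBits k i (g i) % _ = mixBits (k + 1) i (g i) % _
            rw [mixBits_mod, ← Nat.mod_mod_of_dvd (mixBits (k + 1) i (g i))
              (pow_dvd_pow 2 k.le_succ), mixBits_mod, Nat.mod_mod_of_dvd _
              (pow_dvd_pow 2 k.le_succ)]
        · rw [Function.extend_apply' _ _ _ hq]
          exact AgreeOffBit.refl k q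
      refine ⟨1, isFactor_one k, _, ih hk', _, isFactor_copyMatrix agree, ?_⟩
      rw [one_mul, ← copyMatrix_comp]
      congr 1
      ext i
      simp only [Function.comp]
      rw [fac.extend_apply]
  have := key m le_rfl
  convert this using 2
  ext i
  simp [mixBits, Nat.div_eq_of_lt i.isLt, Nat.mod_eq_of_lt (g i).isLt]

/-- Every map factors, up to permutations, through a map that does not increase distances. -/
theorem exists_perm_lipschitz {N : ℕ} (f : Fin N → Fin N) :
    ∃ (σ τ : Equiv.Perm (Fin N)) (g : Fin N → Fin N),
      (∀ i i', Nat.dist (g i) (g i') ≤ Nat.dist i i') ∧ f = τ ∘ g ∘ σ := by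
  classical
  obtain ⟨σ, hσ⟩ : ∃ σ : Equiv.Perm (Fin N), Monotone (f ∘ σ) := ⟨_, Tuple.monotone_sort f⟩
  have hlt : ∀ i, (Finset.univ.image f |>.filter (· < f (σ i))).card < N := fun i => by
    refine (Finset.card_lt_card (t := Finset.univ.image f) ?_).trans_le
      (Finset.card_image_le.trans (by simp))
    rw [Finset.filter_ssubset]
    exact ⟨f (σ i), Finset.mem_image_of_mem _ (Finset.mem_univ _), lt_irrefl _⟩
  -- The rank of `f (σ i)` among the distinct values of `f`. As `f ∘ σ` is sorted, the rank is
  -- monotone and grows by at most one per step.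
  let g : Fin N → Fin N := fun i => ⟨_, hlt i⟩
  have gmono : ∀ i i', i ≤ i' → (g i : ℕ) ≤ g i' := fun i i' h =>
    Finset.card_le_card (Finset.monotone_filter_right (Finset.univ.image f)
      fun v _ (hv : v < f (σ i)) => hv.trans_le (hσ h))
  have gstep : ∀ i i', i ≤ i' → (g i' : ℕ) ≤ g i + (i' - i) := fun i i' h => by
    have hsub : (Finset.univ.image f |>.filter (· < f (σ i'))) ⊆
        (Finset.univ.image f |>.filter (· < f (σ i))) ∪ (Finset.Ico i i').image (f ∘ σ) := by
      intro v hv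
      simp only [Finset.mem_filter, Finset.mem_image, Finset.mem_univ, true_and, Finset.mem_union,
        Finset.mem_Ico, Function.comp] at hv ⊢
      obtain ⟨⟨x, rfl⟩, hx⟩ := hv
      by_cases hxi : f x < f (σ i)
      · exact Or.inl ⟨⟨x, rfl⟩, hxi⟩
      -- If `x` is sorted before `i`, its value equals `f (σ i)`, so `i` itself is a witness.
      · refine Or.inr ⟨max i (σ⁻¹ x), ⟨le_max_left _ _, ?_⟩, ?_⟩
        · refine max_lt (lt_of_le_of_ne h ?_) ?_
          · rintro rfl; exact hxi hx
          · by_contra! hc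
            have := hσ hc
            simp only [Function.comp, apply_inv_self] at this
            exact absurd hx this.not_gt
        · rcases le_total i (σ⁻¹ x) with hc | hc
          · rw [max_eq_right hc, apply_inv_self]
          · rw [max_eq_left hc]
            have := hσ hc
            simp only [Function.comp, apply_inv_self] at this
            exact le_antisymm (not_lt.1 hxi) this
    have h1 := (Finset.card_le_card hsub).trans (Finset.card_union_le _ _)
    have h2 : ((Finset.Ico i i').image (f ∘ σ)).card ≤ i' - i :=
      Finset.card_image_le.trans (by simp)
    exact h1.trans (Nat.add_le_add_left h2 _)
  have ginj : ∀ i i', g i = g i' → f (σ i) = f (σ i') := by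
    have aux : ∀ i i', g i = g i' → ¬ f (σ i) < f (σ i') := by
      intro i i' e hl
      have hss : (Finset.univ.image f |>.filter (· < f (σ i))) ⊂
          (Finset.univ.image f |>.filter (· < f (σ i'))) := by
        refine Finset.ssubset_iff_subset_ne.2 ⟨fun v hv => ?_, fun e' => ?_⟩
        · rw [Finset.mem_filter] at hv ⊢
          exact ⟨hv.1, hv.2.trans hl⟩
        · have : f (σ i) ∈ (Finset.univ.image f |>.filter (· < f (σ i'))) := by
            simp [hl]
          rw [← e'] at this
          simp at this
      exact (Finset.card_lt_card hss).ne (congrArg Fin.val e)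
    intro i i' e
    exact le_antisymm (not_lt.1 (aux _ _ e.symm)) (not_lt.1 (aux _ _ e))
  have gcongr' : ∀ i i', f (σ i) = f (σ i') → g i = g i' := fun i i' e => by
    apply Fin.ext
    simp only [g, e]
  choose φ hφ using fun y : {y // y ∈ Set.range g} => y.2
  -- Ranks correspond bijectively to values; this bijection between subsets of `Fin N` extends to
  -- the permutation `τ`.
  let u : {y // y ∈ Set.range g} → {y // y ∈ Set.range f} := fun y => ⟨f (σ (φ y)), _, rfl⟩
  have hu : Function.Bijective u := by
    constructor
    · intro y y' e
      apply Subtype.ext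
      rw [← hφ y, ← hφ y']
      exact gcongr' _ _ (congrArg Subtype.val e)
    · rintro ⟨_, x, rfl⟩
      refine ⟨⟨g (σ⁻¹ x), _, rfl⟩, Subtype.ext ?_⟩
      have := ginj _ _ (hφ ⟨g (σ⁻¹ x), _, rfl⟩)
      rwa [apply_inv_self] at this
  let τ : Equiv.Perm (Fin N) := (Equiv.ofBijective u hu).extendSubtype
  refine ⟨σ⁻¹, τ, g, fun i i' => ?_, ?_⟩
  · simp only [Nat.dist]
    rcases le_total i i' with h | h
    · have h1 := gmono i i' h
      have h2 := gstep i i' h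
      omega
    · have h1 := gmono i' i h
      have h2 := gstep i' i h
      omega
  · ext x
    have h1 : τ (g (σ⁻¹ x)) = u ⟨g (σ⁻¹ x), _, rfl⟩ :=
      Equiv.extendSubtype_apply_of_mem _ _ _
    have h2 := ginj _ _ (hφ ⟨g (σ⁻¹ x), _, rfl⟩)
    rw [apply_inv_self] at h2
    simp only [Function.comp]
    rw [h1]
    exact congrArg Fin.val h2.symm

end Copying

end Kaleidoscope

namespace Kaleidoscope

/-! ### Combining pairs of coordinates -/

section Combine

variable {F : Type*} [Field F] {m : ℕ}

theorem two_pow_le_two_pow_succ (m : ℕ) : 2 ^ m ≤ 2 ^ (m + 1) :=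
  Nat.pow_le_pow_right two_pos m.le_succ

/-- The matrix with the entries `a i` in the columns `i` and `b i` in the columns `i + 2 ^ m` of
the rows `i < 2 ^ m`, and zeros elsewhere. -/
def combineMatrix (a b : Fin (2 ^ m) → F) :
    Matrix (Fin (2 ^ (m + 1))) (Fin (2 ^ (m + 1))) F :=
  Matrix.of fun p q =>
    if h : (p : ℕ) < 2 ^ m then
      (if p = q then a ⟨p, h⟩ else 0) +
        (if (⟨p + 2 ^ m, by
        have := pow_succ 2 m; omega⟩ : Fin (2 ^ (m + 1))) = q then b ⟨p, h⟩ else 0)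
    else 0

/-- In size `2 ^ (m + 1)` the positions `i` and `i + 2 ^ m` differ only in the top digit. -/
theorem isFactor_combineMatrix (a b : Fin (2 ^ m) → F) : IsFactor m (combineMatrix a b) := by
  intro p q h
  by_cases hp : (p : ℕ) < 2 ^ m
  · have h1 : p ≠ q := fun e => h (e ▸ AgreeOffBit.refl m p)
    have h2 : (⟨p + 2 ^ m, by
        have := pow_succ 2 m; omega⟩ : Fin (2 ^ (m + 1))) ≠ q := by
      rintro rfl
      refine h ⟨?_, by simp⟩
      rw [Nat.div_eq_of_lt p.isLt, Nat.div_eq_of_lt (by have := pow_succ 2 m; simp; omega)]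
    simp [combineMatrix, hp, h1, h2]
  · simp [combineMatrix, hp]

end Combine

/-! ### Products of matrices of `𝓑𝓑*` -/

section Products

variable {F : Type*} [Field F] [StarRing F] {m : ℕ}

theorem mem_BBStarPow_iff {w : ℕ} {X : Matrix (Fin (2 ^ m)) (Fin (2 ^ m)) F} :
    X ∈ BBStarPow F m w ↔
      ∃ l : List (Matrix (Fin (2 ^ m)) (Fin (2 ^ m)) F),
        l.length = w ∧ (∀ Y ∈ l, Y ∈ BBStar F m) ∧ X = l.prod := by
  constructor
  · rintro ⟨f, hf, rfl⟩
    refine ⟨_, by simp, fun Y hY => ?_, rfl⟩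
    rw [List.mem_reverse, List.mem_ofFn] at hY
    obtain ⟨i, rfl⟩ := hY
    exact hf i
  · rintro ⟨l, rfl, hl, rfl⟩
    rw [← List.length_reverse]
    exact ⟨l.reverse.get, fun i => hl _ (List.mem_reverse.1 (List.get_mem _ _)), by
      rw [List.ofFn_get, List.reverse_reverse]⟩

theorem mul_mem_BBStarPow {w w' : ℕ} {X Y : Matrix (Fin (2 ^ m)) (Fin (2 ^ m)) F}
    (hX : X ∈ BBStarPow F m w) (hY : Y ∈ BBStarPow F m w') : X * Y ∈ BBStarPow F m (w + w') := by
  rw [mem_BBStarPow_iff] at *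
  obtain ⟨l, rfl, hl, rfl⟩ := hX
  obtain ⟨l', rfl, hl', rfl⟩ := hY
  refine ⟨l ++ l', List.length_append, fun Y hY => ?_, List.prod_append.symm⟩
  exact (List.mem_append.1 hY).elim (hl Y) (hl' Y)

theorem mem_BBStarPow_one {X : Matrix (Fin (2 ^ m)) (Fin (2 ^ m)) F}
    (hX : X ∈ BenesSet F m m) : X ∈ BBStarPow F m 1 :=
  mem_BBStarPow_iff.2 ⟨[X], rfl, by simpa using benesSet_subset_BBStar hX, by simp⟩

theorem copyMatrix_mem_BBStarPow (f : Fin (2 ^ m) → Fin (2 ^ m)) :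
    copyMatrix F f ∈ BBStarPow F m 3 := by
  obtain ⟨σ, τ, g, hg, rfl⟩ := exists_perm_lipschitz f
  have perm : ∀ π : Equiv.Perm (Fin (2 ^ m)), copyMatrix F π ∈ BBStarPow F m 1 := fun π =>
    mem_BBStarPow_one (copyMatrix_perm_mem_benesSet le_rfl π fun p => by
      rw [Nat.div_eq_of_lt (π p).isLt, Nat.div_eq_of_lt p.isLt])
  rw [copyMatrix_comp, copyMatrix_comp]
  exact mul_mem_BBStarPow (mul_mem_BBStarPow (perm σ)
    (mem_BBStarPow_one (copyMatrix_lipschitz_mem_benesSet g hg))) (perm τ)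

/-- Every linear map to `2 ^ m` coordinates, each a combination of two of the coordinates of the
argument, is computed by four matrices of `𝓑𝓑*` of size `2 ^ (m + 1)`. -/
theorem exists_mem_BBStarPow_combine (a b : Fin (2 ^ m) → F)
    (f₁ f₂ : Fin (2 ^ m) → Fin (2 ^ (m + 1))) :
    ∃ T ∈ BBStarPow F (m + 1) 4, ∀ (x : Fin (2 ^ (m + 1)) → F) (i : Fin (2 ^ m)),
      (T *ᵥ x) (i.castLE (two_pow_le_two_pow_succ m)) = a i * x (f₁ i) + b i * x (f₂ i) := by
  -- First arguments go to the lower half, second arguments to the upper half. The width is 3 for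
  -- this copying and 1 for the combination.
  let f : Fin (2 ^ (m + 1)) → Fin (2 ^ (m + 1)) := fun p =>
    if h : (p : ℕ) < 2 ^ m then f₁ ⟨p, h⟩
    else f₂ ⟨p - 2 ^ m, by have := p.isLt; have := pow_succ 2 m; omega⟩
  refine ⟨combineMatrix a b * copyMatrix F f, mul_mem_BBStarPow (w := 1) (w' := 3)
    (mem_BBStarPow_one ?_) (copyMatrix_mem_BBStarPow f), fun x i => ?_⟩
  · exact ⟨_, isFactor_combineMatrix a b, 1, one_mem_benesSet m, 1, isFactor_one m, by simp⟩
  · rw [← Matrix.mulVec_mulVec, copyMatrix_mulVec]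
    simp [Matrix.mulVec, dotProduct, combineMatrix, add_mul, Finset.sum_add_distrib, f]

theorem exists_params_of_mem_BBStarPow {n w : ℕ} (h : n ≤ 2 ^ m)
    {E : Matrix (Fin (2 ^ m)) (Fin (2 ^ m)) F} (hE : E ∈ BBStarPow F m w) :
    ∃ θ : KParam w m → F, upperLeft h E = kMatrix h θ := by
  obtain ⟨f, hf, rfl⟩ := hE
  choose A hA B hB hf using hf
  choose θ hθ using hA
  choose η hη using hB
  refine ⟨fun t => if t.2.1 then star (η t.1 t.2.2) else θ t.1 t.2.2, ?_⟩
  unfold kMatrix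
  congr 4
  funext i
  simp [hf, hθ, hη]

end Products

/-! ### Circuits -/

section Circuits

variable {F : Type*}

namespace LinearCircuit

variable {n : ℕ}

/-- The inputs and gates of a circuit as a subset of the initial segment of length `N`. -/
def position (c : LinearCircuit F n) {N : ℕ} (h : c.size ≤ N) (z : Fin n ⊕ Fin c.numGates) :
    Fin N := (finSumFinEquiv z).castLE h

theorem position_injective (c : LinearCircuit F n) {N : ℕ} (h : c.size ≤ N) :
    Function.Injective (c.position h) :=
  (Fin.castLE_injective h).comp finSumFinEquiv.injective

end LinearCircuit

variable [Field F]

/-- The vector `v`, extended by zeros. -/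
noncomputable def zeroPad {n N : ℕ} (h : n ≤ N) (v : Fin n → F) : Fin N → F :=
  Function.extend (Fin.castLE h) v 0

theorem zeroPad_castLE {n N : ℕ} (h : n ≤ N) (v : Fin n → F) (i : Fin n) :
    zeroPad h v (i.castLE h) = v i := (Fin.castLE_injective h).extend_apply v 0 i

theorem upperLeft_mulVec {n N : ℕ} (h : n ≤ N) (E : Matrix (Fin N) (Fin N) F) (v : Fin n → F)
    (i : Fin n) : (upperLeft h E *ᵥ v) i = (E *ᵥ zeroPad h v) (i.castLE h) := by
  refine Fintype.sum_of_injective (Fin.castLE h) (Fin.castLE_injective h) _ _ (fun q hq => ?_)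
    fun j => ?_
  · rw [zeroPad, Function.extend_apply' _ _ _ fun ⟨a, ha⟩ => hq ⟨a, ha⟩, Pi.zero_apply, mul_zero]
  · rw [zeroPad_castLE]; rfl

namespace LinearCircuit

variable {n : ℕ}

/-- An argument of the gate `k`, as a gate of the circuit. -/
def liftSource (c : LinearCircuit F n) (k : Fin c.numGates) (z : Fin n ⊕ Fin k) :
    Fin n ⊕ Fin c.numGates := z.map id (Fin.castLE k.isLt.le)

theorem value_eq (c : LinearCircuit F n) (v : Fin n → F) (k : Fin c.numGates) :
    c.value v k = c.α k * Sum.elim v (c.value v) (c.liftSource k (c.src₁ k)) +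
      c.β k * Sum.elim v (c.value v) (c.liftSource k (c.src₂ k)) := by
  have : ∀ z : Fin n ⊕ Fin k, Sum.elim v (c.value v) (c.liftSource k z) =
      Sum.elim v (fun j => c.value v (j.castLE k.isLt.le)) z := by
    rintro (i | j) <;> rfl
  rw [this, this, value]

variable [StarRing F]

/-- Four matrices of `𝓑𝓑*` for every layer of the circuit compute the values of its gates. -/
theorem exists_mem_BBStarPow_layers (c : LinearCircuit F n) {m d : ℕ} (h : c.size ≤ 2 ^ m)
    (ℓ : Fin c.numGates → Fin d) (hℓ : c.IsLayering d ℓ) (hn : n ≤ 2 ^ (m + 1)) (t : ℕ) :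
    ∃ E ∈ BBStarPow F (m + 1) (4 * t), ∀ (v : Fin n → F) (z : Fin n ⊕ Fin c.numGates),
      (∀ k, z = Sum.inr k → (ℓ k : ℕ) < t) →
      (E *ᵥ zeroPad hn v) ((c.position h z).castLE (two_pow_le_two_pow_succ m)) =
        Sum.elim v (c.value v) z := by
  induction t with
  | zero =>
    refine ⟨1, mem_BBStarPow_iff.2 ⟨[], by simp⟩, fun v z hz => ?_⟩
    rcases z with i | k
    · rw [Matrix.one_mulVec]
      exact zeroPad_castLE hn v i
    · exact absurd (hz k rfl) (Nat.not_lt_zero _)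
  | succ t ih =>
    obtain ⟨E, hE, hv⟩ := ih
    let φ : {k : Fin c.numGates // (ℓ k : ℕ) = t} → Fin (2 ^ m) :=
      fun k => c.position h (Sum.inr k)
    have hφ : φ.Injective := (c.position_injective h).comp
      (Sum.inr_injective.comp Subtype.val_injective)
    let P : Fin n ⊕ Fin c.numGates → Fin (2 ^ (m + 1)) :=
      fun z => (c.position h z).castLE (two_pow_le_two_pow_succ m)
    let keep : Fin (2 ^ m) → Fin (2 ^ (m + 1)) := Fin.castLE (two_pow_le_two_pow_succ m)
    -- Slots outside layer `t` get the default `1 * x i + 0 * x i`, so values already computed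
    -- survive; slots of later gates hold irrelevant values.
    obtain ⟨T, hT, hTv⟩ := exists_mem_BBStarPow_combine
      (Function.extend φ (fun k => c.α k) 1) (Function.extend φ (fun k => c.β k) 0)
      (Function.extend φ (fun k => P (c.liftSource k (c.src₁ k))) keep)
      (Function.extend φ (fun k => P (c.liftSource k (c.src₂ k))) keep)
    refine ⟨T * E, by
      have := mul_mem_BBStarPow hT hE
      rwa [show 4 + 4 * t = 4 * (t + 1) by ring] at this, fun v z hz => ?_⟩
    rw [← Matrix.mulVec_mulVec, hTv]
    by_cases hzt : ∃ k : {k : Fin c.numGates // (ℓ k : ℕ) = t}, z = Sum.inr k.1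
    · obtain ⟨k, rfl⟩ := hzt
      rw [show c.position h (Sum.inr k.1) = φ k from rfl]
      rw [hφ.extend_apply, hφ.extend_apply, hφ.extend_apply, hφ.extend_apply, Sum.elim_inr,
        c.value_eq, hv, hv]
      · intro k' hk'
        rcases hs : c.src₂ k with i | j
        · rw [hs] at hk'; exact absurd hk' (by simp [liftSource])
        · rw [hs] at hk'
          obtain rfl := Sum.inr_injective hk'
          exact (Fin.lt_def.1 (hℓ k j (Or.inr hs))).trans_eq k.2
      · intro k' hk'
        rcases hs : c.src₁ k with i | j
        · rw [hs] at hk'; exact absurd hk' (by simp [liftSource])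
        · rw [hs] at hk'
          obtain rfl := Sum.inr_injective hk'
          exact (Fin.lt_def.1 (hℓ k j (Or.inl hs))).trans_eq k.2
    · have hnot : ¬ ∃ k, φ k = c.position h z := fun ⟨k, hk⟩ =>
        hzt ⟨k, (c.position_injective h hk).symm⟩
      rw [Function.extend_apply' _ _ _ hnot, Function.extend_apply' _ _ _ hnot,
        Function.extend_apply' _ _ _ hnot, Pi.one_apply, Pi.zero_apply, one_mul, zero_mul, add_zero]
      refine hv v z fun k hk => lt_of_le_of_ne (Nat.le_of_lt_succ (hz k hk)) fun e =>
        hzt ⟨⟨k, e⟩, hk⟩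

/-- A final copying, of width 3, moves the output values to the first `n` positions. It need not be
a permutation, as several outputs may be read off the same gate. -/
theorem Computes.exists_mem_BBStarPow {c : LinearCircuit F n} {M : Matrix (Fin n) (Fin n) F}
    (hc : c.Computes M) {m d : ℕ} (h : c.size ≤ 2 ^ m) (ℓ : Fin c.numGates → Fin d)
    (hℓ : c.IsLayering d ℓ) (hn : n ≤ 2 ^ (m + 1)) :
    ∃ E ∈ BBStarPow F (m + 1) (3 + 4 * d), M = upperLeft hn E := by
  obtain ⟨E, hE, hv⟩ := c.exists_mem_BBStarPow_layers h ℓ hℓ hn d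
  let f : Fin (2 ^ (m + 1)) → Fin (2 ^ (m + 1)) := Function.extend (Fin.castLE hn)
    (fun i => (c.position h (c.out i)).castLE (two_pow_le_two_pow_succ m)) id
  refine ⟨copyMatrix F f * E, mul_mem_BBStarPow (copyMatrix_mem_BBStarPow f) hE, ?_⟩
  apply Matrix.mulVec_injective
  funext v i
  rw [upperLeft_mulVec, ← Matrix.mulVec_mulVec, copyMatrix_mulVec, ← hc v, Function.comp]
  have : f (i.castLE hn) = _ := (Fin.castLE_injective hn).extend_apply _ _ i
  rw [this, hv v _ fun k _ => (ℓ k).isLt]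
  rfl

end LinearCircuit

end Circuits

end Kaleidoscope

namespace Kaleidoscope

/-! ### Straight-line programs for matrix-vector products -/

section Programs

variable {F ι : Type*} [Field F]

/-- Some straight-line program with at most `k` operations computes all functions in `S`. -/
def Realizable (k : ℕ) (S : Set ((ι → F) → F)) : Prop :=
  ∃ (code : List (Instr ι)) (R : ℕ), code.length ≤ k ∧ ∀ g ∈ S, ∃ a : ι ⊕ ℕ,
    (∀ r, a = Sum.inr r → r < R) ∧
    ∀ x, Sum.elim x (code.foldl (Program.step x) fun _ => 0) a = g x

/-- The result goes to register `R`, which lies above all registers in use, so no earlier value is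
overwritten. -/
theorem Realizable.insert {k : ℕ} {S : Set ((ι → F) → F)} (hS : Realizable k S) (op : FieldOp)
    {g g' : (ι → F) → F} (hg : g ∈ S) (hg' : g' ∈ S) :
    Realizable (k + 1) (insert (fun x => op.apply (g x) (g' x)) S) := by
  obtain ⟨code, R, hk, h⟩ := hS
  obtain ⟨a, -, ha⟩ := h g hg
  obtain ⟨a', -, ha'⟩ := h g' hg'
  refine ⟨code ++ [⟨R, op, a, a'⟩], R + 1, by simpa using hk, ?_⟩
  rintro u (rfl | hu)
  · refine ⟨Sum.inr R, fun r hr => by rw [← Sum.inr_injective hr]; exact R.lt_succ_self,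
      fun x => ?_⟩
    simp [Program.step, ha, ha']
  · obtain ⟨b, hb, hb'⟩ := h u hu
    refine ⟨b, fun r hr => (hb r hr).trans R.lt_succ_self, fun x => ?_⟩
    rw [← hb' x]
    rcases b with i | r
    · rfl
    · simp [Program.step, (hb r rfl).ne]

/-- Applying the matrix `A x`, which depends on the input `x`, to a vector that has been computed
before costs at most `k` operations. -/
def MulVecCost {κ : Type*} [Fintype κ] (A : (ι → F) → Matrix κ κ F) (k : ℕ) : Prop :=
  ∀ (k₀ : ℕ) (S : Set ((ι → F) → F)) (g : κ → (ι → F) → F), (∀ i, (fun x => x i) ∈ S) →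
    (∀ p, g p ∈ S) → Realizable k₀ S →
    ∃ S', S ⊆ S' ∧ Realizable (k₀ + k) S' ∧ ∀ p, (fun x => (A x *ᵥ fun q => g q x) p) ∈ S'

theorem MulVecCost.one {κ : Type*} [Fintype κ] [DecidableEq κ] :
    MulVecCost (fun _ : ι → F => (1 : Matrix κ κ F)) 0 := fun k₀ S g _ hg h =>
  ⟨S, subset_rfl, h, fun p => by simpa using hg p⟩

/-- Costs add because `MulVecCost` allows any previously computed vector as argument and never
discards the inputs that hold the matrix entries. -/
theorem MulVecCost.mul {κ : Type*} [Fintype κ] {A B : (ι → F) → Matrix κ κ F} {k l : ℕ}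
    (hA : MulVecCost A k) (hB : MulVecCost B l) : MulVecCost (fun x => A x * B x) (k + l) := by
  intro k₀ S g hi hg h
  obtain ⟨S₁, hS₁, h₁, hg₁⟩ := hB k₀ S g hi hg h
  obtain ⟨S₂, hS₂, h₂, hg₂⟩ := hA _ S₁ _ (fun i => hS₁ (hi i)) hg₁ h₁
  refine ⟨S₂, hS₁.trans hS₂, ?_, fun p => ?_⟩
  · rwa [add_comm k, ← add_assoc]
  · simpa only [← Matrix.mulVec_mulVec] using hg₂ p

theorem MulVecCost.list_prod {κ : Type*} [Fintype κ] [DecidableEq κ] {k : ℕ}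
    (l : List ((ι → F) → Matrix κ κ F)) (hl : ∀ A ∈ l, MulVecCost A k) :
    MulVecCost (fun x => (l.map fun A => A x).prod) (l.length * k) := by
  induction l with
  | nil => simpa using MulVecCost.one
  | cons A l ih =>
    simp only [List.map_cons, List.prod_cons, List.length_cons, Nat.succ_mul]
    rw [add_comm]
    exact (hl A List.mem_cons_self).mul (ih fun B hB => hl B (List.mem_cons_of_mem _ hB))

theorem MulVecCost.ofFn_prod {κ : Type*} [Fintype κ] [DecidableEq κ] {k n : ℕ}
    (f : Fin n → (ι → F) → Matrix κ κ F) (hf : ∀ i, MulVecCost (f i) k) :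
    MulVecCost (fun x => (List.ofFn fun i => f i x).prod) (n * k) := by
  have := MulVecCost.list_prod (List.ofFn f) (k := k) (by simpa [List.mem_ofFn] using hf)
  simpa [List.map_ofFn, Function.comp_def] using this

theorem MulVecCost.ofFn_reverse_prod {κ : Type*} [Fintype κ] [DecidableEq κ] {k n : ℕ}
    (f : Fin n → (ι → F) → Matrix κ κ F) (hf : ∀ i, MulVecCost (f i) k) :
    MulVecCost (fun x => (List.ofFn fun i => f i x).reverse.prod) (n * k) := by
  have := MulVecCost.list_prod (List.ofFn f).reverse (k := k) (by simpa [List.mem_ofFn] using hf)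
  simpa [List.map_ofFn, Function.comp_def, List.map_reverse] using this

theorem IsFactor.mulVec_apply {m j : ℕ} (hj : j < m) {A : Matrix (Fin (2 ^ m)) (Fin (2 ^ m)) F}
    (hA : IsFactor j A) (x : Fin (2 ^ m) → F) (p : Fin (2 ^ m)) :
    (A *ᵥ x) p = A p (setBit hj p 0) * x (setBit hj p 0) +
      A p (setBit hj p 1) * x (setBit hj p 1) := by
  refine Finset.sum_eq_add _ _ (fun e => ?_) (fun q _ hq => ?_)
    (fun h => absurd (Finset.mem_univ (setBit hj p 0)) h)
    (fun h => absurd (Finset.mem_univ (setBit hj p 1)) h)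
  · have := congrArg (bit j) e
    rw [bit_setBit, bit_setBit] at this
    exact absurd this (by decide)
  · refine mul_eq_zero_of_left (hA p q fun h => ?_) _
    have e := h.setBit_eq hj
    generalize bit j q = c at e
    obtain rfl | rfl : c = 0 ∨ c = 1 := by omega
    · exact hq.1 e.symm
    · exact hq.2 e.symm

/-- Each row takes two multiplications and one addition. -/
theorem MulVecCost.factor {m j : ℕ} (hj : j < m)
    {A : (ι → F) → Matrix (Fin (2 ^ m)) (Fin (2 ^ m)) F} (hA : ∀ x, IsFactor j (A x))
    (hA' : ∀ p q, AgreeOffBit j p q → ∃ i, ∀ x, A x p q = x i) : MulVecCost A (3 * 2 ^ m) := by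
  intro k₀ S g hi hg h
  have key : ∀ T : Finset (Fin (2 ^ m)), ∃ S', S ⊆ S' ∧ Realizable (k₀ + 3 * T.card) S' ∧
      ∀ p ∈ T, (fun x => (A x *ᵥ fun q => g q x) p) ∈ S' := by
    intro T
    induction T using Finset.induction_on with
    | empty => exact ⟨S, subset_rfl, h, by simp⟩
    | insert p T hp ih =>
      obtain ⟨S₁, hS₁, h₁, hT⟩ := ih
      obtain ⟨i, hi'⟩ := hA' p _ (agreeOffBit_setBit hj p 0).symm
      obtain ⟨i', hi''⟩ := hA' p _ (agreeOffBit_setBit hj p 1).symm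
      have h₂ := h₁.insert .mul (hS₁ (hi i)) (hS₁ (hg (setBit hj p 0)))
      have h₃ := h₂.insert .mul (Set.mem_insert_of_mem _ (hS₁ (hi i')))
        (Set.mem_insert_of_mem _ (hS₁ (hg (setBit hj p 1))))
      have h₄ := h₃.insert .add (Set.mem_insert_of_mem _ (Set.mem_insert _ _))
        (Set.mem_insert _ _)
      rw [Finset.card_insert_of_notMem hp]
      refine ⟨_, fun u hu => Or.inr (Or.inr (Or.inr (hS₁ hu))), h₄, fun q hq => ?_⟩
      rcases Finset.mem_insert.1 hq with rfl | hq
      · refine Or.inl (funext fun x => ?_)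
        rw [(hA x).mulVec_apply hj, hi', hi'']
        rfl
      · exact Or.inr (Or.inr (Or.inr (hT q hq)))
  obtain ⟨S', hS', h', hT⟩ := key Finset.univ
  exact ⟨S', hS', by simpa using h', fun p => hT p (Finset.mem_univ p)⟩

theorem butterflyFactorMatrix_apply_of_agree {m j : ℕ} (a : Fin (2 ^ m) → Fin 2 → F)
    {p q : Fin (2 ^ m)} (h : AgreeOffBit j p q) :
    butterflyFactorMatrix m j a p q = a p (bit j q) := by
  unfold AgreeOffBit at h
  simp only [butterflyFactorMatrix, Matrix.of_apply, if_pos h]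
  rfl

theorem MulVecCost.butterflyMatrix {m : ℕ} (i : ButterflyParam m → ι) :
    MulVecCost (fun x : ι → F => butterflyMatrix fun p => x (i p)) (m * (3 * 2 ^ m)) :=
  .ofFn_reverse_prod _ fun j => .factor j.isLt
    (fun _ => isFactor_butterflyFactorMatrix _ _)
    fun _ _ h => ⟨_, fun _ => butterflyFactorMatrix_apply_of_agree _ h⟩

/-- The `star` on the parameters cancels that of the transposition, so all entries that matter are
inputs and the program never has to apply the involution. -/
theorem MulVecCost.butterflyMatrix_conjTranspose [StarRing F] {m : ℕ} (i : ButterflyParam m → ι) :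
    MulVecCost (fun x : ι → F => (Kaleidoscope.butterflyMatrix fun p => star (x (i p)))ᴴ)
      (m * (3 * 2 ^ m)) := by
  have : ∀ x : ι → F, (Kaleidoscope.butterflyMatrix fun p => star (x (i p)))ᴴ =
      (List.ofFn fun j : Fin m => (butterflyFactorMatrix m (j : ℕ)
        (fun p c => star (x (i (j, p, c)))))ᴴ).prod := fun x => by
    rw [Kaleidoscope.butterflyMatrix, Matrix.conjTranspose_list_prod, List.map_reverse,
      List.reverse_reverse, List.map_ofFn]
    rfl
  simp only [this]
  exact .ofFn_prod _ fun j => .factor j.isLt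
    (fun _ => (isFactor_butterflyFactorMatrix _ _).conjTranspose)
    fun p q h => ⟨i (j, q, bit j p), fun x => by
      rw [Matrix.conjTranspose_apply, butterflyFactorMatrix_apply_of_agree _ h.symm, star_star]⟩

theorem exists_program_kMatrix [StarRing F] {n w m : ℕ} (h : n ≤ 2 ^ m) :
    ∃ P : Program (KParam w m ⊕ Fin n) (Fin n), P.numOps ≤ w * (2 * (m * (3 * 2 ^ m))) ∧
      ∀ (θ : KParam w m → F) (v : Fin n → F), P.eval (Sum.elim θ v) = kMatrix h θ *ᵥ v := by
  let K : (KParam w m ⊕ Fin n → F) → Matrix (Fin (2 ^ m)) (Fin (2 ^ m)) F := fun x =>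
    (List.ofFn fun i : Fin w => butterflyMatrix (fun p => x (Sum.inl (i, false, p))) *
      (butterflyMatrix (fun p => star (x (Sum.inl (i, true, p)))))ᴴ).reverse.prod
  have cost : MulVecCost K (w * (2 * (m * (3 * 2 ^ m)))) :=
    .ofFn_reverse_prod _ fun i => by
      rw [two_mul]
      exact (MulVecCost.butterflyMatrix fun p => Sum.inl (i, false, p)).mul
        (MulVecCost.butterflyMatrix_conjTranspose fun p => Sum.inl (i, true, p))
  -- The zero function serves the padding of `v`. It is read from register 0, which the initial
  -- bound `R = 1` protects from being overwritten.
  let S : Set ((KParam w m ⊕ Fin n → F) → F) := insert (fun _ => 0) (Set.range fun i x => x i)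
  have hS : Realizable 0 S := by
    refine ⟨[], 1, le_rfl, ?_⟩
    rintro _ (rfl | ⟨i, rfl⟩)
    · exact ⟨Sum.inr 0, fun r hr => by rw [← Sum.inr_injective hr]; exact Nat.one_pos,
        fun x => rfl⟩
    · exact ⟨Sum.inl i, by simp, fun x => rfl⟩
  obtain ⟨S', -, ⟨code, R, hk, hcode⟩, hg⟩ := cost 0 S
    (fun p x => zeroPad h (fun i => x (Sum.inr i)) p) (fun i => Or.inr ⟨i, rfl⟩)
    (fun p => by
      by_cases hp : ∃ i, Fin.castLE h i = p
      · obtain ⟨i, rfl⟩ := hp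
        exact Or.inr ⟨Sum.inr i, funext fun x => (zeroPad_castLE h (fun i => x (Sum.inr i)) i).symm⟩
      · exact Or.inl (funext fun x => Function.extend_apply' _ _ _ hp)) hS
  choose a _ ha using fun i : Fin n => hcode _ (hg (i.castLE h))
  refine ⟨⟨code, a⟩, hk.trans_eq (zero_add _), fun θ v => funext fun i => ?_⟩
  rw [kMatrix, upperLeft_mulVec]
  exact ha i (Sum.elim θ v)

end Programs

/-! ### Sizes -/

theorem card_kParam (w m : ℕ) :
    Fintype.card (KParam w m) = w * (2 * (m * (2 ^ m * 2))) := by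
  simp [KParam, ButterflyParam]

/-- With `m = Nat.clog 2 s`, `(m + 1) log 2 ≤ log (4 s) ≤ 3 log s` because `s ≥ 2`, and `3 / 0.69 <
5`. -/
theorem exists_exponent {s : ℕ} (hs : 2 ≤ s) :
    ∃ m : ℕ, s ≤ 2 ^ m ∧ 2 ^ (m + 1) ≤ 4 * s ∧ ((m + 1 : ℕ) : ℝ) ≤ 5 * Real.log s := by
  have h1 : 2 ^ (Nat.clog 2 s) ≤ 2 * s := by
    have h := Nat.pow_pred_clog_lt_self one_lt_two (x := s) (by omega)
    have h0 : 0 < Nat.clog 2 s := Nat.clog_pos one_lt_two hs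
    obtain ⟨k, hk⟩ := Nat.exists_eq_succ_of_ne_zero h0.ne'
    rw [hk] at h ⊢
    rw [pow_succ]
    simp only [Nat.pred_succ] at h
    omega
  have h2 : 2 ^ (Nat.clog 2 s + 1) ≤ 4 * s := by rw [pow_succ]; omega
  refine ⟨Nat.clog 2 s, Nat.le_pow_clog one_lt_two s, h2, ?_⟩
  have hs' : (2 : ℝ) ≤ s := by exact_mod_cast hs
  have h3 : Real.log ((2 : ℝ) ^ (Nat.clog 2 s + 1)) ≤ Real.log ((2 : ℝ) ^ 2 * s) :=
    Real.log_le_log (by positivity) (by norm_num; exact_mod_cast h2)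
  rw [Real.log_pow, Real.log_mul (by norm_num) (by positivity), Real.log_pow] at h3
  have h4 : Real.log 2 ≤ Real.log s := Real.log_le_log two_pos hs'
  have h5 := Real.log_two_gt_d9
  have h6 : (0 : ℝ) ≤ ((Nat.clog 2 s + 1 : ℕ) : ℝ) := by positivity
  have h7 : ((Nat.clog 2 s + 1 : ℕ) : ℝ) * 0.69 ≤ ((Nat.clog 2 s + 1 : ℕ) : ℝ) * Real.log 2 :=
    mul_le_mul_of_nonneg_left (by linarith) h6
  norm_num at h3 h7 ⊢
  linarith

theorem cost_bound {w d s m : ℕ} {l : ℝ} (hw : w ≤ 7 * d) (hm : 2 ^ m ≤ 4 * s)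
    (hl : (m : ℝ) ≤ 5 * l) :
    ((w * (2 * (m * (3 * 2 ^ m))) : ℕ) : ℝ) ≤ 1000 * (d * s * l) := by
  have hw' : (w : ℝ) ≤ 7 * d := by exact_mod_cast hw
  have hm' : (2 : ℝ) ^ m ≤ 4 * s := by exact_mod_cast hm
  have h0 : (0 : ℝ) ≤ l := by linarith [(Nat.cast_nonneg m : (0 : ℝ) ≤ m)]
  push_cast
  calc (w : ℝ) * (2 * (m * (3 * 2 ^ m))) ≤ 7 * d * (2 * (5 * l * (3 * (4 * s)))) := by gcongr
    _ = 840 * (d * s * l) := by ring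
    _ ≤ 1000 * (d * s * l) := by gcongr; norm_num

end Kaleidoscope

/-! ### The main theorem: choice of width and expansion -/

theorem theorem1 :
    ∃ C : ℕ, ∀ (F : Type*) [Field F] [StarRing F] (n s d : ℕ) (M : Matrix (Fin n) (Fin n) F)
      (c : Kaleidoscope.LinearCircuit F n),
      c.Computes M → c.size = s → c.depth = d → 1 ≤ d →
      ∃ (w : ℕ) (e : ℚ), w ≤ C * d ∧ e ≤ C * ((s : ℚ) / n) ∧
        M ∈ Kaleidoscope.KClass F n w e ∧
        ∃ (m : ℕ) (h : n ≤ 2 ^ m) (θ : Kaleidoscope.KParam w m → F),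
          (2 : ℚ) ^ m = e * n ∧ M = Kaleidoscope.kMatrix h θ ∧
          (Fintype.card (Kaleidoscope.KParam w m) : ℝ) ≤ C * (d * s * Real.log s) ∧
          ∃ P : Kaleidoscope.Program (Kaleidoscope.KParam w m ⊕ Fin n) (Fin n),
            (P.numOps : ℝ) ≤ C * (d * s * Real.log s) ∧
            ∀ (θ' : Kaleidoscope.KParam w m → F) (v : Fin n → F),
              P.eval (Sum.elim θ' v) = Kaleidoscope.kMatrix h θ' *ᵥ v := by
  refine ⟨1000, fun F _ _ n s d M c hc hs hd hd1 => ?_⟩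
  obtain ⟨ℓ, hℓ⟩ : ∃ ℓ : Fin c.numGates → Fin d, c.IsLayering d ℓ := by
    -- The infimum of the empty set is 0, so depth at least 1 ensures that a layering exists and
    -- that the minimum is attained.
    have := Nat.sInf_mem (Nat.nonempty_of_pos_sInf (hd1.trans_eq hd.symm))
    rwa [← Kaleidoscope.LinearCircuit.depth, hd] at this
  have hgates : 0 < c.numGates := by
    by_contra! h0
    have h0 : c.numGates = 0 := by omega
    have : IsEmpty (Fin c.numGates) := by rw [h0]; infer_instance
    have h1 : c.depth ≤ 0 := Nat.sInf_le ⟨isEmptyElim, fun k => isEmptyElim k⟩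
    omega
  -- The first gate has no earlier gate to read from, so there is an input; with the gate itself
  -- this gives `s ≥ 2`.
  have hn : 0 < n := by
    rcases c.src₁ ⟨0, hgates⟩ with i | j
    · exact i.pos
    · exact absurd j.isLt (Nat.not_lt_zero _)
  have hs2 : 2 ≤ s := by
    rw [← hs, Kaleidoscope.LinearCircuit.size]; omega
  obtain ⟨m, hm, hm4, hlog⟩ := Kaleidoscope.exists_exponent hs2
  have hns : n ≤ s := by rw [← hs]; exact Nat.le_add_right _ _
  have hnm : n ≤ 2 ^ (m + 1) :=
    hns.trans (hm.trans (Kaleidoscope.two_pow_le_two_pow_succ m))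
  obtain ⟨E, hE, hME⟩ := hc.exists_mem_BBStarPow (hs.trans_le hm) ℓ hℓ hnm
  obtain ⟨θ, hθ⟩ := Kaleidoscope.exists_params_of_mem_BBStarPow hnm hE
  obtain ⟨P, hP, hPe⟩ := Kaleidoscope.exists_program_kMatrix (F := F) (w := 3 + 4 * d) hnm
  have hn' : (0 : ℚ) < n := by exact_mod_cast hn
  have he : (2 : ℚ) ^ (m + 1) = 2 ^ (m + 1) / n * n := by field_simp
  have hbound := Kaleidoscope.cost_bound (show 3 + 4 * d ≤ 7 * d by omega) hm4 hlog
  refine ⟨3 + 4 * d, 2 ^ (m + 1) / n, by omega, ?_, ⟨m + 1, hnm, he, E, hE, hME⟩, m + 1, hnm, θ, he,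
    hME.trans hθ, ?_, P, ?_, hPe⟩
  · rw [← mul_div_assoc]
    gcongr
    have : (2 : ℚ) ^ (m + 1) ≤ 4 * s := by exact_mod_cast hm4
    have h0 : (0 : ℚ) ≤ s := by positivity
    push_cast
    linarith
  · rw [Kaleidoscope.card_kParam]
    -- Two parameters per row against three operations per row: the operation bound covers both.
    refine le_trans (Nat.cast_le.2 ?_) hbound
    rw [mul_comm _ 2]
    gcongr
    norm_num
  · exact (Nat.cast_le.2 hP).trans hbound
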